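/- **Setting.** There are $d\ge 1$ divisible goods; a bundle is $x\in[0,1]^d$. At a market $(p,B)\in\mathbb{R}_+^d\times\mathbb{R}_+$ (non-negative prices and budget), an agent with utility function $U:[0,1]^d\to\mathbb{R}_+$ buys the bundle $\widehat U(p,B)$ that maximizes $U(x)$ subject to $\langle p,x\rangle\le B$; among several optimal bundles she takes a cheapest one, and remaining ties are broken in favour of the lexicographically smallest bundle. The function $\widehat U$ is the demand function of $U$. For $0<\rho\le 1$ let $\mathcal{H}_{ces}^{\rho}$ be the class of the CES functions $U_a(x)=\big(\sum_j a_jx_j^{\rho}\big)^{1/\rho}$ with $a\in\mathbb{R}_+^d$, $\sum_j a_j=1$. A learner maps every finite sequence of observations $((p_i,B_i),x_i)$ to a utility function. It learns a class $\mathcal{H}$ from revealed preferences with sample size $m:(0,1)\times(0,1)\to\mathbb{N}$ if for all $\epsilon,\delta\in(0,1)$, every probability distribution $P$ on $\mathbb{R}_+^d\times\mathbb{R}_+$ and every $U\in\mathcal{H}$ without ties (that is, for $P$-almost every $(p,B)$ the cheapest optimal bundle is unique), and every $n\ge m(\epsilon,\delta)$: if $(p_1,B_1),\dots,(p_n,B_n)$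 are drawn i.i.d. from $P$, then with probability at least $1-\delta$ the output $V$ of the learner on the observations $((p_i,B_i),\widehat U(p_i,B_i))_{i\le n}$ satisfies $$\Pr_{(p,B)\sim P}\big[U(\widehat U(p,B))\ne U(\widehat V(p,B))\big]\le\epsilon .$$ **Theorem.** (i) For every $d$ and every $\rho\in(0,1]$ the class $\{\widehat U: U\in\mathcal{H}_{ces}^{\rho}\}$ of demand functions is a $d$-dimensional linear class, as witnessed by the map $\Psi$ with $\Psi((p,B),x)=(x_1^{\rho},\dots,x_d^{\rho})$ if $\langle p,x\rangle\le B$ and $\Psi((p,B),x)=0$ otherwise: for every $U\in\mathcal{H}_{ces}^{\rho}$ there is $w\in\mathbb{R}^d$ such that $\widehat U(p,B)\in\operatorname{argmax}_{x\in[0,1]^d}\langle w,\Psi((p,B),x)\rangle$ for all $(p,B)$. (ii) There is an absolute constant $C>0$ such that for every $d\ge1$ and every known $\rho\in(0,1]$ there are a learner, all of whose outputs belong to $\mathcal{H}_{ces}^{\rho}$, and a function $m$ such that the learner learns $\mathcal{H}_{ces}^{\rho}$ from revealed preferences with sample size $m$, and $$m(\epsilon,\delta)\le C\,\frac{d\log(1/\epsilon)+\log(1/\delta)}{\epsilon}\qquad\text{for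 all } \epsilon\in(0,\tfrac12],\ \delta\in(0,1).$$ -/

import Mathlib

open MeasureTheory
open scoped NNReal

namespace RevealedPreference

/-- A bundle of `d` divisible goods of unit amount each: a vector in `[0,1]^d`. -/
abbrev Bundle (d : ℕ) : Type := Fin d → Set.Icc (0 : ℝ) 1

/-- A pair `(p, B)` of a non-negative price vector and a non-negative budget. -/
abbrev Market (d : ℕ) : Type := (Fin d → ℝ≥0) × ℝ≥0

/-- The price `⟨p, x⟩` of the bundle `x`. -/
def cost {d : ℕ} (p : Fin d → ℝ≥0) (x : Bundle d) : ℝ := ∑ j, (p j : ℝ) * (x j : ℝ)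

/-- The bundles that are affordable at prices and budget `z`. -/
def budgetSet {d : ℕ} (z : Market d) : Set (Bundle d) := {x | cost z.1 x ≤ (z.2 : ℝ)}

/-- The affordable bundles of maximal utility. -/
def optimalBundles {d : ℕ} (U : Bundle d → ℝ) (z : Market d) : Set (Bundle d) :=
  {x | x ∈ budgetSet z ∧ ∀ y ∈ budgetSet z, U y ≤ U x}

/-- The cheapest ones among the optimal bundles. -/
def cheapestOptimal {d : ℕ} (U : Bundle d → ℝ) (z : Market d) : Set (Bundle d) :=
  {x | x ∈ optimalBundles U z ∧ ∀ y ∈ optimalBundles U z, cost z.1 x ≤ cost z.1 y}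

/-- `x` is the bundle bought by an agent with utility function `U`: a cheapest optimal bundle,
remaining ties being broken in favour of the lexicographically smallest one. -/
def IsBought {d : ℕ} (U : Bundle d → ℝ) (z : Market d) (x : Bundle d) : Prop :=
  x ∈ cheapestOptimal U z ∧ ∀ y ∈ cheapestOptimal U z, toLex x ≤ toLex y

open Classical in
/-- The demand function of `U`. The `else` branch is never used for a continuous `U`,
see `isBought_demand`. -/
noncomputable def demand {d : ℕ} (U : Bundle d → ℝ) (z : Market d) : Bundle d :=
  if h : ∃ x, IsBought U z x then h.choose else fun _ => 0

/-- The class of demand functions of a class of utility functions. -/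
def demandClass {d : ℕ} (H : Set (Bundle d → ℝ)) : Set (Market d → Bundle d) := demand '' H

/-- The CES utility function `x ↦ (∑ j, a j * x j ^ ρ) ^ (1 / ρ)`. -/
noncomputable def ces {d : ℕ} (a : Fin d → ℝ) (ρ : ℝ) (x : Bundle d) : ℝ :=
  (∑ j, a j * (x j : ℝ) ^ ρ) ^ (1 / ρ)

/-- The class of CES utility functions with the fixed parameter `ρ` (used for `0 < ρ ≤ 1`). -/
def cesClass (d : ℕ) (ρ : ℝ) : Set (Bundle d → ℝ) :=
  {U | ∃ a : Fin d → ℝ, (∀ j, 0 ≤ a j) ∧ ∑ j, a j = 1 ∧ U = ces a ρ}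

/-- `H` is a `D`-dimensional linear class, as witnessed by the encoding `Ψ`: every `h ∈ H` has a
weight vector `w` such that `h x` maximizes `⟨w, Ψ x y⟩` over all labels `y`, for all `x`. -/
def IsLinearClassVia {X Y : Type*} {D : ℕ} (Ψ : X → Y → Fin D → ℝ) (H : Set (X → Y)) : Prop :=
  ∀ h ∈ H, ∃ w : Fin D → ℝ, ∀ x : X, ∀ y : Y,
    ∑ j, w j * Ψ x y j ≤ ∑ j, w j * Ψ x (h x) j

open Classical in
/-- The encoding of a bundle `x` by `(x_1 ^ ρ, …, x_d ^ ρ)` if `x` is affordable, by `0` if not. -/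
noncomputable def cesEncoding (d : ℕ) (ρ : ℝ) (z : Market d) (x : Bundle d) : Fin d → ℝ :=
  if x ∈ budgetSet z then fun j => (x j : ℝ) ^ ρ else 0

/-- A learner maps finite sequences of observed purchases `((p, B), x)` to utility functions. -/
abbrev Learner (d : ℕ) : Type := (n : ℕ) → (Fin n → Market d × Bundle d) → (Bundle d → ℝ)

/-- The sample of purchases of an agent with utility function `U` in the markets `S i`. -/
noncomputable def purchases {d n : ℕ} (U : Bundle d → ℝ) (S : Fin n → Market d) :
    Fin n → Market d × Bundle d :=
  fun i => (S i, demand U (S i))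

/-- The markets in which the purchase predicted by `V` does not have the utility (under the true
utility function `U`) of the agent's optimal bundle. -/
def errorSet {d : ℕ} (U V : Bundle d → ℝ) : Set (Market d) :=
  {z | U (demand U z) ≠ U (demand V z)}

/-- With probability one, the (cheapest) optimal bundle is unique. -/
def NoTies {d : ℕ} (P : Measure (Market d)) (U : Bundle d → ℝ) : Prop :=
  ∀ᵐ z ∂P, ∃! x, x ∈ cheapestOptimal U z

/-- The learner `A` learns the class `H` of utility functions from revealed preferences with
sample size function `m`: for every distribution `P` on markets and every target `U ∈ H` without
ties, given at least `m ε δ` i.i.d. samples, with probability at least `1 - δ` the output of `A`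
has error at most `ε`. (The measure of a set is an outer measure, so that the failure event is
covered by a measurable event of probability at most `δ`.) -/
def Learns {d : ℕ} (A : Learner d) (H : Set (Bundle d → ℝ)) (m : ℝ → ℝ → ℕ) : Prop :=
  ∀ ε δ : ℝ, 0 < ε → ε < 1 → 0 < δ → δ < 1 →
    ∀ P : Measure (Market d), IsProbabilityMeasure P →
      ∀ U ∈ H, NoTies P U →
        ∀ n : ℕ, m ε δ ≤ n →
          Measure.pi (fun _ : Fin n => P)
              {S | ENNReal.ofReal ε < P (errorSet U (A n (purchases U S)))}
            ≤ ENNReal.ofReal δ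

theorem continuous_cost {d : ℕ} (p : Fin d → ℝ≥0) : Continuous (cost p) := by
  unfold cost
  fun_prop

theorem continuous_ces {d : ℕ} (a : Fin d → ℝ) {ρ : ℝ} (hρ : 0 < ρ) : Continuous (ces a ρ) := by
  unfold ces
  refine Continuous.rpow_const ?_ (fun _ => Or.inr (by positivity))
  refine continuous_finsetSum _ fun j _ => continuous_const.mul ?_
  exact Continuous.rpow_const (by fun_prop) (fun _ => Or.inr hρ.le)

theorem exists_lex_min {d : ℕ} {s : Set (Bundle d)} (hs : IsCompact s) (hne : s.Nonempty) :
    ∃ x ∈ s, ∀ y ∈ s, toLex x ≤ toLex y := by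
  have key : ∀ k : ℕ, k ≤ d → ∃ K : Set (Bundle d), K ⊆ s ∧ IsCompact K ∧ K.Nonempty ∧
      (∀ x ∈ K, ∀ y ∈ s, (∀ i : Fin d, i.1 < k → y i = x i) → y ∈ K) ∧
      (∀ x ∈ K, ∀ y ∈ s, (∀ i : Fin d, i.1 < k → y i = x i) ∨
        ∃ i : Fin d, (∀ j < i, x j = y j) ∧ x i < y i) := by
    intro k
    induction k with
    | zero => exact fun _ => ⟨s, subset_rfl, hs, hne, fun _ _ y hy _ => hy, by simp⟩
    | succ k ih =>
      intro hk
      obtain ⟨K, hKs, hKc, hKne, hK1, hK2⟩ := ih (by omega)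
      set q : Fin d := ⟨k, hk⟩ with hq
      obtain ⟨c, hcK, hc⟩ := hKc.exists_isMinOn hKne (continuous_apply q).continuousOn
      have hsplit : ∀ x y : Bundle d, (∀ i : Fin d, i.1 < k + 1 → y i = x i) ↔
          (∀ i : Fin d, i.1 < k → y i = x i) ∧ y q = x q := by
        intro x y
        refine ⟨fun h => ⟨fun i hi => h i (by omega), h q (by simp [hq])⟩, fun h i hi => ?_⟩
        rcases Nat.lt_succ_iff_lt_or_eq.1 hi with h1 | h1
        · exact h.1 i h1
        · have : i = q := Fin.ext h1
          rw [this]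
          exact h.2
      refine ⟨K ∩ {x | x q = c q}, fun x hx => hKs hx.1,
        hKc.inter_right (isClosed_eq (continuous_apply q) continuous_const), ⟨c, hcK, rfl⟩, ?_, ?_⟩
      · intro x hx y hy hxy
        obtain ⟨h1, h2⟩ := (hsplit x y).1 hxy
        exact ⟨hK1 x hx.1 y hy h1, h2.trans hx.2⟩
      · intro x hx y hy
        rcases hK2 x hx.1 y hy with h | h
        · have hyK := hK1 x hx.1 y hy h
          have hle : x q ≤ y q := by
            have h3 : c q ≤ y q := hc hyK
            have h4 : x q = c q := hx.2
            rw [h4]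
            exact h3
          rcases hle.eq_or_lt with h5 | h5
          · exact Or.inl ((hsplit x y).2 ⟨h, h5.symm⟩)
          · exact Or.inr ⟨q, fun j hj => (h j hj).symm, h5⟩
        · exact Or.inr h
  obtain ⟨K, hKs, -, ⟨x, hx⟩, -, h⟩ := key d le_rfl
  refine ⟨x, hKs hx, fun y hy => ?_⟩
  rcases h x hx y hy with h | ⟨i, hi1, hi2⟩
  · have : y = x := funext fun i => h i i.2
    rw [this]
  · exact le_of_lt ⟨i, hi1, hi2⟩

/-- For a continuous utility function, `demand` is the bundle that is bought. -/
theorem isBought_demand {d : ℕ} {U : Bundle d → ℝ} (hU : Continuous U) (z : Market d) :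
    IsBought U z (demand U z) := by
  have hB : IsCompact (budgetSet z) :=
    (isClosed_le (continuous_cost z.1) continuous_const).isCompact
  have hBne : (budgetSet z).Nonempty := ⟨fun _ => 0, by simp [budgetSet, cost]⟩
  obtain ⟨u, huB, hu⟩ := hB.exists_isMaxOn hBne hU.continuousOn
  have hO : IsCompact (optimalBundles U z) := by
    have : optimalBundles U z = budgetSet z ∩ {x | U u ≤ U x} := by
      ext x
      exact ⟨fun h => ⟨h.1, h.2 u huB⟩, fun h => ⟨h.1, fun y hy => (hu hy).trans h.2⟩⟩
    rw [this]
    exact hB.inter_right (isClosed_le continuous_const hU)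
  obtain ⟨v, hvO, hv⟩ :=
    hO.exists_isMinOn ⟨u, huB, fun y hy => hu hy⟩ (continuous_cost z.1).continuousOn
  have hC : IsCompact (cheapestOptimal U z) := by
    have : cheapestOptimal U z = optimalBundles U z ∩ {x | cost z.1 x ≤ cost z.1 v} := by
      ext x
      exact ⟨fun h => ⟨h.1, h.2 v hvO⟩, fun h => ⟨h.1, fun y hy => h.2.trans (hv hy)⟩⟩
    rw [this]
    exact hO.inter_right (isClosed_le (continuous_cost z.1) continuous_const)
  have hex : ∃ x, IsBought U z x := by
    obtain ⟨x, hx, hx'⟩ := exists_lex_min hC ⟨v, hvO, fun y hy => hv hy⟩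
    exact ⟨x, hx, hx'⟩
  unfold demand
  rw [dif_pos hex]
  exact hex.choose_spec

end RevealedPreference

/-! Part (i) holds with `w = a`: `ces a ρ` is an increasing function of `powSum a ρ`, and the linear
score of an affordable bundle is exactly `powSum a ρ`.

For (ii), a purchase without ties satisfies certain strict inequalities in the true weights.
Replacing them by weak inequalities with margin 1 defines `Explains`, which cuts out a closed convex
set of weights for each purchase. Large multiples of the true weights lie in all these sets
(`eventually_explains`), and any weights in such a set, once normalized, predict the purchase
exactly (`Explains.demand_eq`). Learning thus means finding a point common to `n` random closed
convex sets in dimension `d` that also lies in most further sets of the same kind.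

The learner takes the point of minimal norm. By Helly's theorem it is already the point of minimal
norm for some `d` of the sets (`exists_card_eq_isMinNorm`), so the sample compresses to `d`
observations. For a fixed choice of these, the remaining `n - d` observations are independent of the
hypothesis, and each is consistent with a bad one with probability at most `1 - ε`. A union bound
gives the failure probability `n.choose d * (1 - ε) ^ (n - d)` (`pi_minNorm_error_le`), and
`choose_mul_pow_le` turns it into a sample size. Fubini's theorem needs the hypothesis to depend
measurably on the sample; this rests on the uniqueness of minimal norm points and, for demand, on
the absence of ties. -/

namespace RevealedPreference

/-! ### Measurable projections -/

section Measurability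

open Filter Topology

/-- The projection of the sublevel set of countably many Carathéodory functions is measurable. -/
theorem measurableSet_exists_forall_nonpos {X Y ι : Type*} [MeasurableSpace X] [MetricSpace Y]
    [SigmaCompactSpace Y] [Countable ι] {A : Set Y} (hA : IsClosed A) {F : ι → X → Y → ℝ}
    (hm : ∀ m y, Measurable fun x => F m x y) (hc : ∀ m x, Continuous (F m x)) :
    MeasurableSet {x | ∃ y ∈ A, ∀ m, F m x y ≤ 0} := by
  have compact_case : ∀ C : Set Y, IsCompact C →
      MeasurableSet {x | ∃ y ∈ C, ∀ m, F m x y ≤ 0} := by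
    intro C hC
    rcases isEmpty_or_nonempty ι with hι | hι
    · simp
    obtain ⟨e, he⟩ := exists_surjective_nat ι
    obtain ⟨D, hDC, hDc, hD⟩ := hC.isSeparable.exists_countable_dense_subset
    have : {x | ∃ y ∈ C, ∀ m, F m x y ≤ 0} =
        ⋂ n : ℕ, ⋃ y ∈ D, ⋂ m ∈ Set.Iic n, {x | F (e m) x y < 1 / ((n : ℝ) + 1)} := by
      ext x
      simp only [Set.mem_ofPred_eq, Set.mem_iInter, Set.mem_iUnion, Set.mem_Iic, exists_prop]
      constructor
      · rintro ⟨y, hyC, hy⟩ n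
        have hopen : IsOpen (⋂ m ∈ Set.Iic n, {y' | F (e m) x y' < 1 / ((n : ℝ) + 1)}) :=
          (Set.finite_Iic n).isOpen_biInter fun m _ => isOpen_lt (hc _ _) continuous_const
        have hmem : y ∈ ⋂ m ∈ Set.Iic n, {y' | F (e m) x y' < 1 / ((n : ℝ) + 1)} := by
          simp only [Set.mem_iInter, Set.mem_ofPred_eq]
          exact fun m _ => (hy (e m)).trans_lt (by positivity)
        obtain ⟨y', hy', hy'D⟩ := mem_closure_iff.1 (hD hyC) _ hopen hmem
        exact ⟨y', hy'D, by simpa using hy'⟩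
      · intro h
        -- The `n`-th approximate solution meets the first `n + 1` constraints up to `1 / (n + 1)`,
        -- so each fixed constraint is imposed from some stage on and survives in the limit.
        choose y hyD hy using h
        obtain ⟨c, hcC, φ, hφ, hlim⟩ := hC.tendsto_subseq fun n => hDC (hyD n)
        refine ⟨c, hcC, fun m => ?_⟩
        obtain ⟨k, rfl⟩ := he m
        refine le_of_tendsto_of_tendsto (((hc (e k) x).tendsto c).comp hlim)
          (tendsto_one_div_add_atTop_nhds_zero_nat.comp hφ.tendsto_atTop) ?_
        filter_upwards [eventually_ge_atTop k] with n hn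
        exact (hy (φ n) k (hn.trans (hφ.id_le n))).le
    rw [this]
    refine MeasurableSet.iInter fun n => MeasurableSet.biUnion hDc fun y _ =>
      MeasurableSet.biInter (Set.to_countable _) fun m _ => measurableSet_lt (hm _ _)
        measurable_const
  have : {x | ∃ y ∈ A, ∀ m, F m x y ≤ 0} =
      ⋃ n, {x | ∃ y ∈ compactCovering Y n ∩ A, ∀ m, F m x y ≤ 0} := by
    ext x
    simp only [Set.mem_ofPred_eq, Set.mem_iUnion]
    constructor
    · rintro ⟨y, hy, h⟩
      obtain ⟨n, hn⟩ := exists_mem_compactCovering y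
      exact ⟨n, y, ⟨hn, hy⟩, h⟩
    · rintro ⟨n, y, hy, h⟩
      exact ⟨y, hy.2, h⟩
  rw [this]
  exact MeasurableSet.iUnion fun n =>
    compact_case _ ((isCompact_compactCovering Y n).inter_right hA)

end Measurability

/-! ### Points of minimal norm: uniqueness, Helly's theorem, measurability -/

section MinNorm

variable {E : Type*} [NormedAddCommGroup E] [InnerProductSpace ℝ E]

/-- `w` is a point of minimal norm of `K`. -/
def IsMinNorm (K : Set E) (w : E) : Prop := w ∈ K ∧ ∀ b ∈ K, ‖w‖ ≤ ‖b‖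

open Classical in
/-- The point of minimal norm of `K` if there is one, and `0` otherwise. -/
noncomputable def minNormPoint (K : Set E) : E :=
  if h : ∃ w, IsMinNorm K w then h.choose else 0

/-- The midpoint of `v` and `w` lies in `K`, so its norm is at least the common norm of both; the
parallelogram law then forces `v - w = 0`. -/
theorem IsMinNorm.unique {K : Set E} (hK : Convex ℝ K) {v w : E} (hv : IsMinNorm K v)
    (hw : IsMinNorm K w) : v = w := by
  have hvw : ‖v‖ = ‖w‖ := le_antisymm (hv.2 w hw.1) (hw.2 v hv.1)
  have hmid : (1 / 2 : ℝ) • v + (1 / 2 : ℝ) • w ∈ K :=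
    hK hv.1 hw.1 (by norm_num) (by norm_num) (by norm_num)
  have h1 := hv.2 _ hmid
  rw [← smul_add, norm_smul, Real.norm_of_nonneg (by norm_num : (0 : ℝ) ≤ 1 / 2)] at h1
  have h2 := parallelogram_law_with_norm ℝ v w
  have h3 : ‖v - w‖ = 0 := by
    have h4 : 0 ≤ ‖v‖ := norm_nonneg v
    have h5 : (2 * ‖v‖) * (2 * ‖v‖) ≤ ‖v + w‖ * ‖v + w‖ :=
      mul_self_le_mul_self (by positivity) (by linarith)
    rw [← hvw] at h2
    have h6 : ‖v - w‖ * ‖v - w‖ ≤ 0 := by linarith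
    exact mul_self_eq_zero.1 (le_antisymm h6 (mul_self_nonneg _))
  exact sub_eq_zero.1 (norm_eq_zero.1 h3)

theorem exists_isMinNorm [FiniteDimensional ℝ E] {K : Set E} (hK : IsClosed K)
    (hne : K.Nonempty) : ∃ w, IsMinNorm K w := by
  have := FiniteDimensional.proper_real E
  obtain ⟨w, hw, h⟩ := hK.exists_infDist_eq_dist hne 0
  refine ⟨w, hw, fun b hb => ?_⟩
  have := Metric.infDist_le_dist_of_mem (x := (0 : E)) hb
  rw [h] at this
  simpa using this

theorem isMinNorm_minNormPoint [FiniteDimensional ℝ E] {K : Set E} (hK : IsClosed K)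
    (hne : K.Nonempty) : IsMinNorm K (minNormPoint K) := by
  have h := exists_isMinNorm hK hne
  unfold minNormPoint
  rw [dif_pos h]
  exact h.choose_spec

/-- The point of minimal norm of an intersection of finitely many convex sets is that of the
intersection of some `finrank ℝ E` of them. -/
theorem exists_card_eq_isMinNorm [FiniteDimensional ℝ E] {n : ℕ} {K : Fin n → Set E}
    (hconv : ∀ i, Convex ℝ (K i)) (hn : Module.finrank ℝ E ≤ n) {w : E}
    (hw : IsMinNorm (⋂ i, K i) w) :
    ∃ I : Finset (Fin n), I.card = Module.finrank ℝ E ∧ IsMinNorm (⋂ i ∈ I, K i) w := by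
  classical
  have hwK : ∀ i, w ∈ K i := Set.mem_iInter.1 hw.1
  -- The open ball joins the family: a point common to all the sets would beat the minimal norm
  -- `‖w‖`.
  let G : Option (Fin n) → Set E := fun o => o.elim (Metric.ball 0 ‖w‖) K
  have hempty : ¬ (⋂ o ∈ (Finset.univ : Finset (Option (Fin n))), G o).Nonempty := by
    rintro ⟨b, hb⟩
    simp only [Finset.mem_univ, Set.iInter_true, Set.mem_iInter] at hb
    have h1 : b ∈ Metric.ball (0 : E) ‖w‖ := hb none
    have h2 : ‖w‖ ≤ ‖b‖ := hw.2 b (Set.mem_iInter.2 fun i => hb (some i))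
    rw [mem_ball_zero_iff] at h1
    linarith
  have hG : ∀ o ∈ (Finset.univ : Finset (Option (Fin n))), Convex ℝ (G o) := by
    rintro (_ | i) -
    · exact convex_ball _ _
    · exact hconv i
  have hJ : ∃ J : Finset (Option (Fin n)), J.card ≤ Module.finrank ℝ E + 1 ∧
      ¬ (⋂ o ∈ J, G o).Nonempty := by
    by_contra! h
    exact hempty (Convex.helly_theorem' hG fun J _ hJ => h J hJ)
  obtain ⟨J, hJc, hJ⟩ := hJ
  -- Since `w` lies in every `K i`, only a subfamily containing the ball can have empty
  -- intersection. Removing the ball leaves at most `finrank ℝ E` of the sets `K i`.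
  have hnone : none ∈ J := by
    by_contra h
    refine hJ ⟨w, Set.mem_iInter₂.2 ?_⟩
    rintro (_ | i) ho
    · exact absurd ho h
    · exact hwK i
  have hcard : (Finset.eraseNone J).card ≤ Module.finrank ℝ E := by
    have h1 : (Finset.eraseNone J).card = (J.erase none).card := by
      rw [← Finset.map_some_eraseNone, Finset.card_map]
    rw [h1, Finset.card_erase_of_mem hnone]
    omega
  obtain ⟨I, hI1, -, hI2⟩ := Finset.exists_subsuperset_card_eq
    (Finset.subset_univ (Finset.eraseNone J)) hcard (by simpa using hn)
  refine ⟨I, hI2, Set.mem_iInter₂.2 fun i _ => hwK i, fun b hb => ?_⟩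
  by_contra! hlt
  refine hJ ⟨b, Set.mem_iInter₂.2 ?_⟩
  rintro (_ | i) ho
  · exact mem_ball_zero_iff.2 hlt
  · exact Set.mem_iInter₂.1 hb i (hI1 (Finset.mem_eraseNone.2 ho))

variable [FiniteDimensional ℝ E] [MeasurableSpace E] [BorelSpace E]

/-- The point of minimal norm depends measurably on a parameter. -/
theorem measurable_minNormPoint {X ι : Type*} [MeasurableSpace X] [Countable ι]
    {F : ι → X → E → ℝ} (hm : ∀ m b, Measurable fun x => F m x b)
    (hc : ∀ m x, Continuous (F m x)) (hconv : ∀ x, Convex ℝ {b | ∀ m, F m x b ≤ 0}) :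
    Measurable fun x => minNormPoint {b | ∀ m, F m x b ≤ 0} := by
  have := FiniteDimensional.proper_real E
  set w : X → E := fun x => minNormPoint {b | ∀ m, F m x b ≤ 0} with hw
  have hclosed : ∀ x, IsClosed {b | ∀ m, F m x b ≤ 0} := fun x => by
    simp only [Set.ofPred_forall]
    exact isClosed_iInter fun m => isClosed_le (hc m x) continuous_const
  have hmin : ∀ x, (∃ b ∈ Set.univ, ∀ m, F m x b ≤ 0) →
      IsMinNorm {b | ∀ m, F m x b ≤ 0} (w x) := fun x ⟨b, _, hb⟩ =>
    isMinNorm_minNormPoint (hclosed x) ⟨b, hb⟩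
  have hzero : ∀ x, ¬ (∃ b ∈ Set.univ, ∀ m, F m x b ≤ 0) → w x = 0 := fun x h =>
    dif_neg fun ⟨b, hb, _⟩ => h ⟨b, trivial, hb⟩
  have hN : MeasurableSet {x | ∃ b ∈ Set.univ, ∀ m, F m x b ≤ 0} :=
    measurableSet_exists_forall_nonpos isClosed_univ hm hc
  have hr : Measurable fun x => ‖w x‖ := by
    refine measurable_of_Iic fun t => ?_
    have : (fun x => ‖w x‖) ⁻¹' Set.Iic t =
        {x | ∃ b ∈ Metric.closedBall (0 : E) t, ∀ m, F m x b ≤ 0} ∪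
          ({x | ∃ b ∈ Set.univ, ∀ m, F m x b ≤ 0}ᶜ ∩ {_x | 0 ≤ t}) := by
      ext x
      by_cases hx : ∃ b ∈ Set.univ, ∀ m, F m x b ≤ 0
      · simp only [Set.mem_preimage, Set.mem_Iic, Set.mem_union, Set.mem_ofPred_eq,
          Set.mem_inter_iff, Set.mem_compl_iff, hx, not_true, false_and, or_false,
          mem_closedBall_zero_iff]
        exact ⟨fun h => ⟨w x, h, (hmin x hx).1⟩, fun ⟨b, hb, h⟩ => ((hmin x hx).2 b h).trans hb⟩
      · have h2 : ¬ ∃ b ∈ Metric.closedBall (0 : E) t, ∀ m, F m x b ≤ 0 :=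
          fun ⟨b, _, h⟩ => hx ⟨b, trivial, h⟩
        simp only [Set.mem_preimage, Set.mem_Iic, Set.mem_union, Set.mem_ofPred_eq, h2,
          Set.mem_inter_iff, Set.mem_compl_iff, hx, not_false_eq_true, true_and, false_or,
          hzero x hx, norm_zero]
    rw [this]
    exact (measurableSet_exists_forall_nonpos Metric.isClosed_closedBall hm hc).union
      (hN.compl.inter (MeasurableSet.const _))
  refine measurable_of_isClosed fun A hA => ?_
  -- By uniqueness, a feasible point of norm at most `‖w x‖` is `w x` itself. This is why the norm
  -- is shown to be measurable beforehand. The second set accounts for the default value `0`.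
  have : w ⁻¹' A =
      {x | ∃ b ∈ A, ∀ o : Option ι, o.elim (‖b‖ - ‖w x‖) (fun m => F m x b) ≤ 0} ∪
        ({x | ∃ b ∈ Set.univ, ∀ m, F m x b ≤ 0}ᶜ ∩ {_x | (0 : E) ∈ A}) := by
    ext x
    simp only [Option.forall, Option.elim, sub_nonpos]
    by_cases hx : ∃ b ∈ Set.univ, ∀ m, F m x b ≤ 0
    · simp only [Set.mem_preimage, Set.mem_union, Set.mem_ofPred_eq,
        Set.mem_inter_iff, Set.mem_compl_iff, hx, not_true, false_and, or_false]
      refine ⟨fun h => ⟨w x, h, le_rfl, (hmin x hx).1⟩, fun ⟨b, hb, h1, h2⟩ => ?_⟩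
      have : IsMinNorm {b | ∀ m, F m x b ≤ 0} b :=
        ⟨h2, fun b' hb' => h1.trans ((hmin x hx).2 b' hb')⟩
      rwa [(hmin x hx).unique (hconv x) this]
    · have h2 : ¬ ∃ b ∈ A, ‖b‖ ≤ ‖(0 : E)‖ ∧ ∀ m, F m x b ≤ 0 :=
        fun ⟨b, _, _, h⟩ => hx ⟨b, trivial, h⟩
      simp only [Set.mem_preimage, Set.mem_union, Set.mem_ofPred_eq,
        Set.mem_inter_iff, Set.mem_compl_iff, hx, not_false_eq_true, true_and, false_or,
        hzero x hx, h2]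
  rw [this]
  refine (measurableSet_exists_forall_nonpos hA ?_ ?_).union
    (hN.compl.inter (MeasurableSet.const _))
  · rintro (_ | m) b
    · exact measurable_const.sub hr
    · exact hm m b
  · rintro (_ | m) x
    · exact continuous_norm.sub continuous_const
    · exact hc m x

end MinNorm

/-! ### Generalization bound by sample compression -/

section Compression

open scoped ENNReal

variable {X : Type*} [MeasurableSpace X] (P : Measure X) [IsProbabilityMeasure P]

/-- A hypothesis that is determined by the sample points with indices in `I` and has error more
than `ε` is consistent with the other sample points with small probability only. -/
theorem pi_consistent_le {W : Type*} [MeasurableSpace W] {n : ℕ} (I : Finset (Fin n))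
    {w : ({i // i ∈ I} → X) → W} (hw : Measurable w) {D : Set (W × X)} (hD : MeasurableSet D)
    (ε : ℝ≥0∞) :
    Measure.pi (fun _ : Fin n => P)
        {S | ε < P {z | (w fun i => S i, z) ∉ D} ∧ ∀ i ∉ I, (w fun i => S i, S i) ∈ D}
      ≤ (1 - ε) ^ (n - I.card) := by
  let e := MeasurableEquiv.piEquivPiSubtypeProd (fun _ : Fin n => X) (· ∈ I)
  let T : Set (({i // i ∈ I} → X) × ({i // i ∉ I} → X)) :=
    {q | ε < P {z | (w q.1, z) ∉ D} ∧ ∀ j, (w q.1, q.2 j) ∈ D}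
  have hT : MeasurableSet T := by
    have h1 : Measurable fun q : ({i // i ∈ I} → X) × ({i // i ∉ I} → X) =>
        P {z | (w q.1, z) ∉ D} :=
      (measurable_measure_prodMk_left (ν := P) hD.compl).comp (hw.comp measurable_fst)
    have h2 : MeasurableSet {q : ({i // i ∈ I} → X) × ({i // i ∉ I} → X) |
        ∀ j, (w q.1, q.2 j) ∈ D} := by
      rw [Set.ofPred_forall]
      exact MeasurableSet.iInter fun j => ((hw.comp measurable_fst).prodMk
        ((measurable_pi_apply j).comp measurable_snd)) hD
    exact (measurableSet_lt measurable_const h1).inter h2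
  have hpre : {S : Fin n → X | ε < P {z | (w fun i => S i, z) ∉ D} ∧
      ∀ i ∉ I, (w fun i => S i, S i) ∈ D} = e ⁻¹' T := by
    ext S
    simp only [Set.mem_ofPred_eq, Set.mem_preimage, T, Subtype.forall]
    rfl
  rw [hpre, (measurePreserving_piEquivPiSubtypeProd (fun _ : Fin n => P)
    (· ∈ I)).measure_preimage hT.nullMeasurableSet, Measure.prod_apply hT]
  -- Once the coordinates in `I` are fixed, so is the hypothesis, and consistency with the others is
  -- a product event.
  have hsec : ∀ s : {i // i ∈ I} → X,
      Measure.pi (fun _ : {i // i ∉ I} => P) (Prod.mk s ⁻¹' T) ≤ (1 - ε) ^ (n - I.card) := by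
    intro s
    by_cases hs : ε < P {z | (w s, z) ∉ D}
    · have hpi : Prod.mk s ⁻¹' T = Set.univ.pi fun _ : {i // i ∉ I} => {z | (w s, z) ∈ D} := by
        ext t
        simp [T, hs]
      have hgood : MeasurableSet {z | (w s, z) ∈ D} := measurable_prodMk_left hD
      have hle : P {z | (w s, z) ∈ D} ≤ 1 - ε := by
        have h2 := prob_compl_eq_one_sub (μ := P) hgood.compl
        rw [compl_compl] at h2
        rw [h2]
        exact tsub_le_tsub_left hs.le 1
      have hcard : Fintype.card {i // i ∉ I} = n - I.card := by
        rw [Fintype.card_subtype_compl, Fintype.card_fin, Fintype.card_coe]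
      rw [hpi, Measure.pi_pi, Finset.prod_const, Finset.card_univ, hcard]
      exact pow_le_pow_left' hle _
    · have hpi : Prod.mk s ⁻¹' T = ∅ := by
        ext t
        simp [T, hs]
      simp [hpi]
  exact (lintegral_mono hsec).trans (by simp)

/-- The generalization bound for the learner that outputs the point of minimal norm of the set of
all hypotheses consistent with the sample, if these sets are closed and convex. -/
theorem pi_minNorm_error_le {E : Type*} [NormedAddCommGroup E] [InnerProductSpace ℝ E]
    [FiniteDimensional ℝ E] [MeasurableSpace E] [BorelSpace E] {ι : Type*} [Countable ι]
    {F : ι → X → E → ℝ} (hm : ∀ m b, Measurable fun x => F m x b)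
    (hc : ∀ m x, Continuous (F m x)) (hconv : ∀ x, Convex ℝ {b | ∀ m, F m x b ≤ 0})
    (ε : ℝ≥0∞) {n : ℕ} (hn : Module.finrank ℝ E ≤ n) :
    Measure.pi (fun _ : Fin n => P)
        {S | ∃ w, IsMinNorm (⋂ i, {b | ∀ m, F m (S i) b ≤ 0}) w ∧
          ε < P {z | w ∉ {b | ∀ m, F m z b ≤ 0}}}
      ≤ n.choose (Module.finrank ℝ E) * (1 - ε) ^ (n - Module.finrank ℝ E) := by
  have := FiniteDimensional.proper_real E
  let D : Set (E × X) := {q | ∀ m, F m q.2 q.1 ≤ 0}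
  have hD : MeasurableSet D := by
    simp only [D, Set.ofPred_forall]
    exact MeasurableSet.iInter fun m => measurableSet_le
      (measurable_uncurry_of_continuous_of_measurable
        (u := fun (b : E) (x : X) => F m x b) (hc m) (hm m)) measurable_const
  let w : (I : Finset (Fin n)) → ({i // i ∈ I} → X) → E := fun I s =>
    minNormPoint {b | ∀ p : {i // i ∈ I} × ι, F p.2 (s p.1) b ≤ 0}
  have hset : ∀ (I : Finset (Fin n)) (s : {i // i ∈ I} → X),
      {b | ∀ p : {i // i ∈ I} × ι, F p.2 (s p.1) b ≤ 0} =
        ⋂ i : {i // i ∈ I}, {b | ∀ m, F m (s i) b ≤ 0} := by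
    intro I s
    ext b
    simp
  have hconvI : ∀ (I : Finset (Fin n)) (s : {i // i ∈ I} → X),
      Convex ℝ {b | ∀ p : {i // i ∈ I} × ι, F p.2 (s p.1) b ≤ 0} := fun I s => by
    rw [hset]
    exact convex_iInter fun i => hconv (s i)
  have hclosed : ∀ (I : Finset (Fin n)) (s : {i // i ∈ I} → X),
      IsClosed {b | ∀ p : {i // i ∈ I} × ι, F p.2 (s p.1) b ≤ 0} := fun I s => by
    simp only [Set.ofPred_forall]
    exact isClosed_iInter fun p => isClosed_le (hc _ _) continuous_const
  have hw : ∀ I, Measurable (w I) := fun I =>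
    measurable_minNormPoint (fun p b => (hm p.2 b).comp (measurable_pi_apply p.1))
      (fun p s => hc p.2 (s p.1)) (hconvI I)
  have hsub : {S : Fin n → X | ∃ w, IsMinNorm (⋂ i, {b | ∀ m, F m (S i) b ≤ 0}) w ∧
        ε < P {z | w ∉ {b | ∀ m, F m z b ≤ 0}}} ⊆
      ⋃ I ∈ Finset.powersetCard (Module.finrank ℝ E) (Finset.univ : Finset (Fin n)),
        {S | ε < P {z | (w I fun i => S i, z) ∉ D} ∧ ∀ i ∉ I, (w I fun i => S i, S i) ∈ D} := by
    rintro S ⟨v, hv, hε⟩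
    obtain ⟨I, hI, hvI⟩ := exists_card_eq_isMinNorm (fun i => hconv (S i)) hn hv
    have hvw : v = w I fun i => S i := by
      have hset' : (⋂ i ∈ I, {b | ∀ m, F m (S i) b ≤ 0}) =
          {b | ∀ p : {i // i ∈ I} × ι, F p.2 (S p.1) b ≤ 0} := by
        rw [hset I fun i => S i, Set.iInter_subtype]
      rw [hset'] at hvI
      exact hvI.unique (hconvI I fun i => S i)
        (isMinNorm_minNormPoint (hclosed I fun i => S i) ⟨v, hvI.1⟩)
    simp only [Set.mem_iUnion, Finset.mem_powersetCard_univ]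
    refine ⟨I, hI, ?_⟩
    rw [Set.mem_ofPred_eq, ← hvw]
    exact ⟨hε, fun i _ => Set.mem_iInter.1 hv.1 i⟩
  calc _ ≤ _ := measure_mono hsub
    _ ≤ ∑ I ∈ Finset.powersetCard (Module.finrank ℝ E) (Finset.univ : Finset (Fin n)), _ :=
        measure_biUnion_finset_le _ _
    _ ≤ ∑ I ∈ Finset.powersetCard (Module.finrank ℝ E) (Finset.univ : Finset (Fin n)),
          (1 - ε) ^ (n - Module.finrank ℝ E) := Finset.sum_le_sum fun I hI => by
        rw [← Finset.mem_powersetCard_univ.1 hI]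
        exact pi_consistent_le P I (hw I) hD ε
    _ = _ := by simp

end Compression

/-! ### Estimating the sample size -/

/-- The number of samples that suffices. -/
theorem choose_mul_pow_le {d n : ℕ} (hd : 0 < d) {ε δ : ℝ} (hε : 0 < ε) (hε2 : ε ≤ 1 / 2)
    (hδ : 0 < δ) (hδ1 : δ < 1)
    (hn : 6 * (((d : ℝ) * Real.log (1 / ε) + Real.log (1 / δ)) / ε) ≤ n) :
    d ≤ n ∧ (n.choose d : ℝ) * (1 - ε) ^ (n - d) ≤ δ := by
  set L := Real.log (1 / ε) with hL
  set M := Real.log (1 / δ) with hM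
  have hd1 : (1 : ℝ) ≤ d := by exact_mod_cast hd
  have hlog2 : (0.69 : ℝ) < Real.log 2 := by
    have := Real.log_two_gt_d9
    linarith
  have hL2 : Real.log 2 ≤ L := Real.log_le_log (by norm_num) (by
    rw [le_div_iff₀ hε]
    linarith)
  have hM0 : 0 ≤ M := Real.log_nonneg (by
    rw [le_div_iff₀ hδ]
    linarith)
  have hεn : 6 * (d * L + M) ≤ ε * n := by
    have := mul_le_mul_of_nonneg_left hn hε.le
    have h2 : ε * (6 * ((d * L + M) / ε)) = 6 * (d * L + M) := by field_simp
    linarith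
  have hdL : (d : ℝ) * 0.69 ≤ d * L := mul_le_mul_of_nonneg_left (by linarith) (by linarith)
  have hdn' : (d : ℝ) ≤ n := by
    have h1 : ε * n ≤ 1 / 2 * n := mul_le_mul_of_nonneg_right hε2 (Nat.cast_nonneg n)
    nlinarith
  have hdn : d ≤ n := by exact_mod_cast hdn'
  refine ⟨hdn, ?_⟩
  have hn0 : (0 : ℝ) < n := by linarith
  have hd0 : (0 : ℝ) < d := by linarith
  have h1 : (n.choose d : ℝ) ≤ Real.exp (d * Real.log (n / d) + d) := by
    calc (n.choose d : ℝ) ≤ (n : ℝ) ^ d / (d.factorial : ℝ) := Nat.choose_le_pow_div d n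
      _ = ((n : ℝ) / d) ^ d * ((d : ℝ) ^ d / d.factorial) := by
          rw [div_pow]
          field_simp
      _ ≤ ((n : ℝ) / d) ^ d * Real.exp d := by
          gcongr
          exact Real.pow_div_factorial_le_exp _ hd0.le d
      _ = _ := by
          rw [Real.exp_add, ← Real.log_pow, Real.exp_log (by positivity)]
  have h2 : (1 - ε) ^ (n - d) ≤ Real.exp (-(ε * (n - d))) := by
    calc (1 - ε) ^ (n - d) ≤ (Real.exp (-ε)) ^ (n - d) :=
          pow_le_pow_left₀ (by linarith) (Real.one_sub_le_exp_neg ε) _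
      _ = _ := by
          rw [← Real.exp_nat_mul, Nat.cast_sub hdn]
          congr 1
          ring
  -- Split `n / d` as `(ε * (n / d) / 4) * (4 / ε)` and apply `log t ≤ t - 1` to the first factor
  -- only. The 4 makes the linear term cost just a quarter of the decay `ε * n`.
  have h3 : Real.log (n / d) ≤ ε * (n / d) / 4 - 1 + (2 * Real.log 2 + L) := by
    have hx : (n : ℝ) / d = (ε * (n / d) / 4) * (2 * 2 * (1 / ε)) := by
      field_simp
      norm_num
    have h4 := Real.log_le_sub_one_of_pos (show 0 < ε * (n / d) / 4 by positivity)
    have h5 : Real.log (2 * 2 * (1 / ε)) = 2 * Real.log 2 + L := by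
      rw [Real.log_mul (by norm_num) (by positivity), Real.log_mul (by norm_num) (by norm_num)]
      ring
    rw [hx, Real.log_mul (by positivity) (by positivity), h5]
    rw [← hx]
    linarith
  have h6 : (d : ℝ) * Real.log (n / d) ≤ ε * n / 4 - d + d * (3 * L) := by
    calc (d : ℝ) * Real.log (n / d) ≤ d * (ε * (n / d) / 4 - 1 + 3 * L) :=
          mul_le_mul_of_nonneg_left (by linarith) hd0.le
      _ = _ := by
          field_simp
  have h7 : ε * d ≤ d * L := by
    rw [mul_comm]
    exact mul_le_mul_of_nonneg_left (by linarith) hd0.le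
  calc (n.choose d : ℝ) * (1 - ε) ^ (n - d)
      ≤ Real.exp (d * Real.log (n / d) + d) * Real.exp (-(ε * (n - d))) :=
        mul_le_mul h1 h2 (pow_nonneg (by linarith) _) (Real.exp_nonneg _)
    _ = Real.exp (d * Real.log (n / d) + d + -(ε * (n - d))) := (Real.exp_add _ _).symm
    _ ≤ Real.exp (-M) := by
        -- The exponent is at most `-(3 / 4) * ε * n + 4 * d * L`, and `ε * n ≥ 6 * (d * L + M)`
        -- brings it below `-M`.
        refine Real.exp_le_exp.2 ?_
        have : 0 ≤ d * L := by linarith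
        nlinarith
    _ = δ := by rw [hM, one_div, Real.log_inv, neg_neg, Real.exp_log hδ]

variable {d : ℕ}

/-! ### Power sums and exchanges of goods -/

section Optimality

/-- The sum `∑ j, b j * x j ^ ρ`, a monotone transform of a CES function. -/
noncomputable def powSum (b : Fin d → ℝ) (ρ : ℝ) (x : Bundle d) : ℝ := ∑ j, b j * (x j : ℝ) ^ ρ

theorem continuous_powSum (b : Fin d → ℝ) {ρ : ℝ} (hρ : 0 < ρ) : Continuous (powSum b ρ) := by
  unfold powSum
  refine continuous_finsetSum _ fun j _ => continuous_const.mul ?_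
  exact Continuous.rpow_const (by fun_prop) (fun _ => Or.inr hρ.le)

theorem powSum_nonneg {b : Fin d → ℝ} (hb : ∀ j, 0 ≤ b j) (ρ : ℝ) (x : Bundle d) :
    0 ≤ powSum b ρ x :=
  Finset.sum_nonneg fun j _ => mul_nonneg (hb j) (Real.rpow_nonneg (x j).2.1 _)

theorem powSum_smul (c : ℝ) (b : Fin d → ℝ) (ρ : ℝ) (x : Bundle d) :
    powSum (c • b) ρ x = c * powSum b ρ x := by
  simp [powSum, Finset.mul_sum, mul_assoc]

theorem powSum_add (b c : Fin d → ℝ) (ρ : ℝ) (x : Bundle d) :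
    powSum (b + c) ρ x = powSum b ρ x + powSum c ρ x := by
  simp [powSum, add_mul, Finset.sum_add_distrib]

theorem powSum_mono {b : Fin d → ℝ} (hb : ∀ j, 0 ≤ b j) {ρ : ℝ} (hρ : 0 ≤ ρ) {x y : Bundle d}
    (h : ∀ j, 0 < b j → x j ≤ y j) : powSum b ρ x ≤ powSum b ρ y :=
  Finset.sum_le_sum fun j _ => by
    rcases (hb j).eq_or_lt with h0 | h0
    · simp [← h0]
    · exact mul_le_mul_of_nonneg_left (Real.rpow_le_rpow (x j).2.1 (h j h0) hρ) (hb j)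

theorem ces_le_ces_iff {b : Fin d → ℝ} (hb : ∀ j, 0 ≤ b j) {ρ : ℝ} (hρ : 0 < ρ) (x y : Bundle d) :
    ces b ρ x ≤ ces b ρ y ↔ powSum b ρ x ≤ powSum b ρ y :=
  Real.rpow_le_rpow_iff (powSum_nonneg hb ρ x) (powSum_nonneg hb ρ y) (by positivity)

theorem cost_le_cost (p : Fin d → ℝ≥0) {x y : Bundle d} (h : ∀ j, x j ≤ y j) :
    cost p x ≤ cost p y :=
  Finset.sum_le_sum fun j _ => mul_le_mul_of_nonneg_left (h j) (p j).2

theorem cheapestOptimal_congr {U V : Bundle d → ℝ} (h : ∀ x y, U x ≤ U y ↔ V x ≤ V y)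
    (z : Market d) : cheapestOptimal U z = cheapestOptimal V z := by
  simp only [cheapestOptimal, optimalBundles, h]

theorem cheapestOptimal_ces {b : Fin d → ℝ} (hb : ∀ j, 0 ≤ b j) {ρ : ℝ} (hρ : 0 < ρ)
    (z : Market d) : cheapestOptimal (ces b ρ) z = cheapestOptimal (powSum b ρ) z :=
  cheapestOptimal_congr (ces_le_ces_iff hb hρ) z

theorem cheapestOptimal_powSum_smul {c : ℝ} (hc : 0 < c) (b : Fin d → ℝ) (ρ : ℝ) (z : Market d) :
    cheapestOptimal (powSum (c • b) ρ) z = cheapestOptimal (powSum b ρ) z :=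
  cheapestOptimal_congr (fun x y => by
    rw [powSum_smul, powSum_smul, mul_le_mul_iff_right₀ hc]) z

theorem demand_mem_cheapestOptimal {U : Bundle d → ℝ} (hU : Continuous U) (z : Market d) :
    demand U z ∈ cheapestOptimal U z := (isBought_demand hU z).1

theorem mem_cheapestOptimal_of_le {U : Bundle d → ℝ} {z : Market d} {x y : Bundle d}
    (hx : x ∈ cheapestOptimal U z) (hU : U x ≤ U y) (hc : cost z.1 y ≤ cost z.1 x) :
    y ∈ cheapestOptimal U z :=
  ⟨⟨hc.trans hx.1.1, fun w hw => (hx.1.2 w hw).trans hU⟩, fun w hw => hc.trans (hx.2 w hw)⟩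

theorem sum_update (g : Fin d → Set.Icc (0 : ℝ) 1 → ℝ) (x : Bundle d) (k : Fin d)
    (c : Set.Icc (0 : ℝ) 1) :
    ∑ j, g j (Function.update x k c j) = ∑ j, g j (x j) + (g k c - g k (x k)) := by
  rw [← Finset.add_sum_erase _ _ (Finset.mem_univ k),
    ← Finset.add_sum_erase (a := k) _ (fun j => g j (x j)) (Finset.mem_univ k)]
  have : ∑ j ∈ Finset.univ.erase k, g j (Function.update x k c j) =
      ∑ j ∈ Finset.univ.erase k, g j (x j) :=
    Finset.sum_congr rfl fun j hj => by rw [Function.update_of_ne (Finset.ne_of_mem_erase hj)]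
  rw [this, Function.update_self]
  ring

/-- Buying more of the good `u` and less of the good `v` at the same total cost. -/
theorem exists_swap (p : Fin d → ℝ≥0) {x : Bundle d} {u v : Fin d} (huv : u ≠ v)
    (hu : x u < 1) (hv : 0 < x v) :
    ∃ t : ℝ, 0 < t ∧ ∃ y : Bundle d, cost p y = cost p x ∧
      (y v : ℝ) = x v - t * p u ∧
      ∀ b, powSum b 1 y = powSum b 1 x + t * (b u * p v - b v * p u) := by
  have hu' : (x u : ℝ) < 1 := hu
  have hv' : (0 : ℝ) < x v := hv
  have hpu : (0 : ℝ) ≤ p u := (p u).2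
  have hpv : (0 : ℝ) ≤ p v := (p v).2
  set m : ℝ := min (1 - x u) (x v) with hm
  have hm0 : 0 < m := lt_min (by linarith) hv'
  have hden : (0 : ℝ) < p u + p v + 1 := by linarith
  -- The summand 1 keeps the denominator positive when both prices vanish; both coordinates stay in
  -- `[0, 1]` because `t * p u` and `t * p v` are at most `m`.
  set t : ℝ := m / (p u + p v + 1) with ht
  have ht0 : 0 < t := by positivity
  have htm : t * (p u + p v + 1) = m := by
    rw [ht]
    field_simp
  have hmu : m ≤ 1 - x u := min_le_left _ _
  have hmv : m ≤ x v := min_le_right _ _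
  have h1 : 0 ≤ t * p u := by positivity
  have h2 : 0 ≤ t * p v := by positivity
  have hxv : (x v : ℝ) ≤ 1 := (x v).2.2
  have hxu : (0 : ℝ) ≤ x u := (x u).2.1
  refine ⟨t, ht0, Function.update (Function.update x u ⟨x u + t * p v, ?_, ?_⟩) v
    ⟨x v - t * p u, ?_, ?_⟩, ?_, ?_, fun b => ?_⟩
  · linarith
  · nlinarith
  · nlinarith
  · linarith
  · unfold cost
    rw [sum_update (fun j c => (p j : ℝ) * c), sum_update (fun j c => (p j : ℝ) * c),
      Function.update_of_ne huv.symm]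
    ring
  · rw [Function.update_self]
  · unfold powSum
    rw [sum_update (fun j (c : Set.Icc (0 : ℝ) 1) => b j * (c : ℝ) ^ (1 : ℝ)),
      sum_update (fun j (c : Set.Icc (0 : ℝ) 1) => b j * (c : ℝ) ^ (1 : ℝ)),
      Function.update_of_ne huv.symm]
    simp only [Real.rpow_one]
    ring

end Optimality

/-! ### Strict inequalities forced by uniqueness -/

section Ties

variable {a : Fin d → ℝ} {ρ : ℝ} {z : Market d} {x : Bundle d}

/-- If good `k` were free, raising it to a full unit would give another cheapest optimal bundle. -/
theorem price_pos_of_lt_one (ha : ∀ j, 0 ≤ a j) (hρ : 0 < ρ)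
    (hx : x ∈ cheapestOptimal (powSum a ρ) z) (hu : ∀ y ∈ cheapestOptimal (powSum a ρ) z, y = x)
    {k : Fin d} (hk : x k < 1) : 0 < z.1 k := by
  by_contra h
  have h0 : z.1 k = 0 := le_antisymm (not_lt.1 h) zero_le
  have hle : ∀ j, x j ≤ Function.update x k 1 j := fun j => by
    rcases eq_or_ne j k with rfl | hj
    · rw [Function.update_self]
      exact hk.le
    · rw [Function.update_of_ne hj]
  have := hu (Function.update x k 1) (mem_cheapestOptimal_of_le hx
    (powSum_mono ha hρ.le fun j _ => hle j) (by
      unfold cost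
      rw [sum_update (fun j c => (z.1 j : ℝ) * c), h0]
      simp))
  have h1 := congrFun this k
  rw [Function.update_self] at h1
  exact hk.ne h1.symm

/-- If good `j` had no value, dropping it would give another cheapest optimal bundle. -/
theorem weight_pos_of_pos (ha : ∀ j, 0 ≤ a j)
    (hx : x ∈ cheapestOptimal (powSum a ρ) z) (hu : ∀ y ∈ cheapestOptimal (powSum a ρ) z, y = x)
    {j : Fin d} (hj : 0 < x j) : 0 < a j := by
  by_contra h
  have h0 : a j = 0 := le_antisymm (not_lt.1 h) (ha j)
  have hle : ∀ i, Function.update x j 0 i ≤ x i := fun i => by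
    rcases eq_or_ne i j with rfl | hi
    · rw [Function.update_self]
      exact hj.le
    · rw [Function.update_of_ne hi]
  have := hu (Function.update x j 0) (mem_cheapestOptimal_of_le hx (by
      unfold powSum
      rw [sum_update (fun i (c : Set.Icc (0 : ℝ) 1) => a i * (c : ℝ) ^ ρ), h0]
      simp) (cost_le_cost _ hle))
  have h1 := congrFun this j
  rw [Function.update_self] at h1
  exact hj.ne h1

/-- Otherwise trading some of `j` for `k` at equal cost loses no utility. Since `k` has a positive
price, the trade really changes the amount of `j`, contradicting uniqueness. -/
theorem swap_pos (ha : ∀ j, 0 ≤ a j)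
    (hx : x ∈ cheapestOptimal (powSum a 1) z) (hu : ∀ y ∈ cheapestOptimal (powSum a 1) z, y = x)
    {j k : Fin d} (hjk : j ≠ k) (hj : 0 < x j) (hk : x k < 1) :
    0 < a j * z.1 k - a k * z.1 j := by
  by_contra! h
  obtain ⟨t, ht, y, hyc, hyj, hy⟩ := exists_swap z.1 hjk.symm hk hj
  have hp : (0 : ℝ) < z.1 k := price_pos_of_lt_one ha one_pos hx hu hk
  have := hu y (mem_cheapestOptimal_of_le hx (by
    rw [hy a]
    nlinarith) hyc.le)
  rw [this] at hyj
  nlinarith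

end Ties

/-! ### Weights that explain a purchase -/

section Explains

/-- The weights `b` explain the purchase of `x` in the market `z`, with a margin that excludes
ties. -/
structure Explains (ρ : ℝ) (z : Market d) (x : Bundle d) (b : Fin d → ℝ) : Prop where
  nonneg : ∀ j, 0 ≤ b j
  one_le_sum : 1 ≤ ∑ j, b j
  optimal : ∀ y ∈ budgetSet z, powSum b ρ y ≤ powSum b ρ x
  one_le : ∀ j, 0 < x j → 1 ≤ b j
  one_le_swap : ρ = 1 → ∀ j k, j ≠ k → 0 < x j → x k < 1 → 1 ≤ b j * z.1 k - b k * z.1 j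

/-- With the purchase fixed, every condition is a weak linear inequality in the weights. -/
theorem Explains.convexCombination {ρ : ℝ} {z : Market d} {x : Bundle d} {b c : Fin d → ℝ}
    (hb : Explains ρ z x b) (hc : Explains ρ z x c) {s t : ℝ} (hs : 0 ≤ s) (ht : 0 ≤ t)
    (hst : s + t = 1) : Explains ρ z x (s • b + t • c) := by
  have one_le : ∀ {u v : ℝ}, 1 ≤ u → 1 ≤ v → 1 ≤ s * u + t * v := fun {u v} hu hv => by
    have h1 := mul_le_mul_of_nonneg_left hu hs
    have h2 := mul_le_mul_of_nonneg_left hv ht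
    linarith
  refine ⟨fun j => ?_, ?_, fun y hy => ?_, fun j hj => ?_, fun h j k hjk hj hk => ?_⟩
  · exact add_nonneg (mul_nonneg hs (hb.nonneg j)) (mul_nonneg ht (hc.nonneg j))
  · have := one_le hb.one_le_sum hc.one_le_sum
    simpa [Finset.sum_add_distrib, Finset.mul_sum] using this
  · simp only [powSum_add, powSum_smul]
    exact add_le_add (mul_le_mul_of_nonneg_left (hb.optimal y hy) hs)
      (mul_le_mul_of_nonneg_left (hc.optimal y hy) ht)
  · exact one_le (hb.one_le j hj) (hc.one_le j hj)
  · have := one_le (hb.one_le_swap h j k hjk hj hk) (hc.one_le_swap h j k hjk hj hk)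
    simp only [Pi.add_apply, Pi.smul_apply, smul_eq_mul]
    linarith

open Filter in
/-- Large multiples of the true weights explain a purchase without ties. -/
theorem eventually_explains {a : Fin d → ℝ} (ha : ∀ j, 0 ≤ a j) (hsum : ∑ j, a j = 1) {ρ : ℝ}
    {z : Market d} {x : Bundle d} (hx : x ∈ cheapestOptimal (powSum a ρ) z)
    (hu : ∀ y ∈ cheapestOptimal (powSum a ρ) z, y = x) :
    ∀ᶠ t : ℝ in atTop, Explains ρ z x (t • a) := by
  -- Scaling turns strict positivity into a margin of 1; only finitely many margins are required, so
  -- one threshold serves all.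
  have large : ∀ (p : Prop) (c : ℝ), (p → 0 < c) → ∀ᶠ t : ℝ in atTop, p → 1 ≤ t * c := by
    intro p c hc
    by_cases hp : p
    · filter_upwards [(tendsto_id.atTop_mul_const (hc hp)).eventually_ge_atTop 1] with t ht _
      exact ht
    · exact Eventually.of_forall fun t h => absurd h hp
  have h1 := eventually_all.2 fun j : Fin d =>
    large (0 < x j) (a j) (weight_pos_of_pos ha hx hu)
  have h2 := eventually_all.2 fun j : Fin d => eventually_all.2 fun k : Fin d =>
    large (ρ = 1 ∧ j ≠ k ∧ 0 < x j ∧ x k < 1) (a j * z.1 k - a k * z.1 j) (by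
      rintro ⟨rfl, hjk, hj, hk⟩
      exact swap_pos ha hx hu hjk hj hk)
  filter_upwards [h1, h2, eventually_ge_atTop 1] with t h1 h2 ht
  have ht0 : 0 ≤ t := by linarith
  refine ⟨fun j => mul_nonneg ht0 (ha j), ?_, fun y hy => ?_, fun j hj => h1 j hj,
    fun h j k hjk hj hk => ?_⟩
  · simp only [Pi.smul_apply, smul_eq_mul, ← Finset.mul_sum, hsum, mul_one]
    exact ht
  · simp only [powSum_smul]
    exact mul_le_mul_of_nonneg_left (hx.1.2 y hy) ht0
  · have := h2 j k ⟨h, hjk, hj, hk⟩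
    simp only [Pi.smul_apply, smul_eq_mul]
    linarith

/-- If the exponent is less than one, then two maximizers agree on all goods of positive
weight. -/
theorem eq_of_optimal {b : Fin d → ℝ} (hb : ∀ j, 0 ≤ b j) {ρ : ℝ} (hρ : 0 < ρ) (hρ1 : ρ < 1)
    {z : Market d} {x y : Bundle d} (hx : x ∈ budgetSet z) (hy : y ∈ budgetSet z)
    (hxo : ∀ w ∈ budgetSet z, powSum b ρ w ≤ powSum b ρ x)
    (hyo : ∀ w ∈ budgetSet z, powSum b ρ w ≤ powSum b ρ y) {j : Fin d} (hj : 0 < b j) :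
    x j = y j := by
  by_contra hne
  -- The midpoint is affordable and, by strict concavity in coordinate `j`, strictly better than
  -- both maximizers.
  let m : Bundle d := fun i => ⟨(1 / 2) * (x i : ℝ) + (1 / 2) * (y i : ℝ),
    by have := (x i).2.1; have := (y i).2.1; linarith,
    by have := (x i).2.2; have := (y i).2.2; linarith⟩
  have hxy : powSum b ρ x = powSum b ρ y := le_antisymm (hyo x hx) (hxo y hy)
  have hm : m ∈ budgetSet z := by
    have h1 : cost z.1 m = (1 / 2) * cost z.1 x + (1 / 2) * cost z.1 y := by
      simp only [cost, Finset.mul_sum, ← Finset.sum_add_distrib, m]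
      exact Finset.sum_congr rfl fun i _ => by ring
    have h2 : cost z.1 x ≤ z.2 := hx
    have h3 : cost z.1 y ≤ z.2 := hy
    change cost z.1 m ≤ z.2
    linarith
  have hconc := Real.strictConcaveOn_rpow hρ hρ1
  have hlt : (1 / 2) * powSum b ρ x + (1 / 2) * powSum b ρ y < powSum b ρ m := by
    simp only [powSum, Finset.mul_sum, ← Finset.sum_add_distrib]
    refine Finset.sum_lt_sum (fun i _ => ?_) ⟨j, Finset.mem_univ j, ?_⟩
    · have := hconc.concaveOn.2 (x i).2.1 (y i).2.1 one_half_pos.le one_half_pos.le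
        (add_halves 1)
      have := mul_le_mul_of_nonneg_left this (hb i)
      simp only [smul_eq_mul] at this
      simp only [m]
      linarith
    · have := hconc.2 (x j).2.1 (y j).2.1 (fun h => hne (Subtype.ext h)) one_half_pos
        one_half_pos (add_halves 1)
      have := mul_lt_mul_of_pos_left this hj
      simp only [smul_eq_mul] at this
      simp only [m]
      linarith
  have := hxo m hm
  linarith

/-- If the exponent is one and the optimality of `x` has a margin, then every optimal bundle
contains `x`. -/
theorem le_of_optimal {b : Fin d → ℝ} {z : Market d} {x y : Bundle d}
    (hx : x ∈ budgetSet z) (hb : Explains 1 z x b) (hy : y ∈ budgetSet z)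
    (hyo : ∀ w ∈ budgetSet z, powSum b 1 w ≤ powSum b 1 y) (j : Fin d) : x j ≤ y j := by
  by_contra! hj
  have hxj : 0 < x j := lt_of_le_of_lt (y j).2.1 hj
  have hbj := hb.one_le j hxj
  -- If `y` has more of some `k`, trading `k` for `j` in `y` improves it by the swap margin. If not,
  -- `x` dominates `y` and is strictly better through `j`.
  by_cases h : ∃ k, x k < y k
  · obtain ⟨k, hk⟩ := h
    have hjk : j ≠ k := by
      rintro rfl
      exact lt_asymm hj hk
    obtain ⟨t, ht, w, hwc, -, hw⟩ := exists_swap z.1 hjk (lt_of_lt_of_le hj (x j).2.2)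
      (lt_of_le_of_lt (x k).2.1 hk)
    have h1 := hb.one_le_swap rfl j k hjk hxj (lt_of_lt_of_le hk (y k).2.2)
    have h2 := hyo w (hwc.le.trans hy)
    rw [hw b] at h2
    nlinarith
  · push Not at h
    have h1 : powSum b 1 y < powSum b 1 x := by
      refine Finset.sum_lt_sum (fun i _ => ?_) ⟨j, Finset.mem_univ j, ?_⟩
      · simp only [Real.rpow_one]
        exact mul_le_mul_of_nonneg_left (h i) (hb.nonneg i)
      · simp only [Real.rpow_one]
        exact mul_lt_mul_of_pos_left hj (by linarith)
    have := hyo x hx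
    linarith

/-- Weights that explain a purchase without ties predict it. -/
theorem Explains.demand_eq {a b : Fin d → ℝ} (ha : ∀ j, 0 ≤ a j) {ρ : ℝ} (hρ : 0 < ρ)
    (hρ1 : ρ ≤ 1) {z : Market d} (hz : ∃! x, x ∈ cheapestOptimal (ces a ρ) z)
    (hb : Explains ρ z (demand (ces a ρ) z) b) :
    demand (ces ((∑ j, b j)⁻¹ • b) ρ) z = demand (ces a ρ) z := by
  have hs : 0 < (∑ j, b j)⁻¹ := inv_pos.2 (by linarith [hb.one_le_sum])
  have hy := demand_mem_cheapestOptimal (continuous_ces ((∑ j, b j)⁻¹ • b) hρ) z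
  have hsb : ∀ j, 0 ≤ ((∑ j, b j)⁻¹ • b) j := fun j => mul_nonneg hs.le (hb.nonneg j)
  rw [cheapestOptimal_ces hsb hρ, cheapestOptimal_powSum_smul hs] at hy
  have hx := demand_mem_cheapestOptimal (continuous_ces a hρ) z
  have hu : ∀ y ∈ cheapestOptimal (ces a ρ) z, y = demand (ces a ρ) z :=
    fun y h => hz.unique h hx
  rw [cheapestOptimal_ces ha hρ] at hx hu
  set y := demand (ces ((∑ j, b j)⁻¹ • b) ρ) z
  set x := demand (ces a ρ) z
  have hxy : ∀ j, x j ≤ y j := by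
    intro j
    rcases hρ1.eq_or_lt with rfl | hρ1
    · exact le_of_optimal hx.1.1 hb hy.1.1 hy.1.2 j
    · by_cases hj : 0 < x j
      · exact (eq_of_optimal hb.nonneg hρ hρ1 hx.1.1 hy.1.1 hb.optimal hy.1.2
          (by linarith [hb.one_le j hj])).le
      · exact (not_lt.1 hj).trans (y j).2.1
  -- The bundle `x` is optimal for `b` too, so the cheapest optimal `y` costs no more. But any good
  -- that `y` has in excess of `x` has a positive price, by uniqueness under the true weights `a`.
  have hcost : cost z.1 y ≤ cost z.1 x := hy.2 x ⟨hx.1.1, hb.optimal⟩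
  by_contra hne
  obtain ⟨k, hk⟩ := Function.ne_iff.1 hne
  have hlt : x k < y k := lt_of_le_of_ne (hxy k) (Ne.symm hk)
  have hp : (0 : ℝ) < z.1 k :=
    price_pos_of_lt_one ha hρ hx hu (lt_of_lt_of_le hlt (y k).2.2)
  have : cost z.1 x < cost z.1 y :=
    Finset.sum_lt_sum (fun j _ => mul_le_mul_of_nonneg_left (hxy j) (z.1 j).2)
      ⟨k, Finset.mem_univ k, mul_lt_mul_of_pos_left hlt hp⟩
  linarith

end Explains

/-! ### Countably many measurable constraints -/

section Constraints

/-- A bundle on a grid. -/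
noncomputable def gridPoint (g : ℕ × (Fin d → ℕ)) : Bundle d :=
  fun j => ⟨min 1 ((g.2 j : ℝ) / ((g.1 : ℝ) + 1)), le_min zero_le_one (by positivity),
    min_le_left _ _⟩

open Filter Topology in
/-- The affordable grid bundles are dense among the affordable bundles. -/
theorem le_of_forall_gridPoint_le {U : Bundle d → ℝ} (hU : Continuous U) {z : Market d} {c : ℝ}
    (h : ∀ g, gridPoint g ∈ budgetSet z → U (gridPoint g) ≤ c) {y : Bundle d}
    (hy : y ∈ budgetSet z) : U y ≤ c := by
  -- Rounding down never raises the cost, so the approximating grid points remain affordable.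
  let g : ℕ → ℕ × (Fin d → ℕ) := fun n => (n, fun j => ⌊(y j : ℝ) * ((n : ℝ) + 1)⌋₊)
  have hle : ∀ n j, (gridPoint (g n) j : ℝ) ≤ y j := fun n j => by
    refine (min_le_right _ _).trans ?_
    rw [div_le_iff₀ (by positivity)]
    exact Nat.floor_le (mul_nonneg (y j).2.1 (by positivity))
  have hge : ∀ (n : ℕ) j, (y j : ℝ) - 1 / ((n : ℝ) + 1) ≤ gridPoint (g n) j := fun n j => by
    have hn : (0 : ℝ) < (n : ℝ) + 1 := by positivity
    refine le_min ?_ ?_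
    · have := (y j).2.2
      have : 0 ≤ 1 / ((n : ℝ) + 1) := by positivity
      linarith
    · rw [le_div_iff₀ hn, sub_mul, one_div_mul_cancel hn.ne']
      have := Nat.lt_floor_add_one ((y j : ℝ) * ((n : ℝ) + 1))
      simp only [g]
      linarith
  have hlim : Tendsto (fun n => gridPoint (g n)) atTop (𝓝 y) := by
    refine tendsto_pi_nhds.2 fun j => tendsto_subtype_rng.2 ?_
    refine tendsto_of_tendsto_of_tendsto_of_le_of_le ?_ tendsto_const_nhds
      (fun n => hge n j) (fun n => hle n j)
    simpa using (tendsto_const_nhds (x := (y j : ℝ))).sub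
      (tendsto_one_div_add_atTop_nhds_zero_nat (𝕜 := ℝ))
  exact le_of_tendsto ((hU.tendsto y).comp hlim)
    (Eventually.of_forall fun n => h _ ((cost_le_cost z.1 (hle n)).trans hy))

/-- The index set of countably many inequalities that express `Explains`. -/
abbrev ConstraintIndex (d : ℕ) : Type :=
  Fin d ⊕ Unit ⊕ (ℕ × (Fin d → ℕ)) ⊕ Fin d ⊕ (Fin d × Fin d)

open Classical in
/-- The weights `b` explain the purchase `(z, x)` if all these functions are nonpositive. -/
noncomputable def constraint (ρ : ℝ) :
    ConstraintIndex d → Market d × Bundle d → EuclideanSpace ℝ (Fin d) → ℝ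
  | .inl j, _, b => -b j
  | .inr (.inl _), _, b => 1 - ∑ j, b j
  | .inr (.inr (.inl g)), q, b =>
      if gridPoint g ∈ budgetSet q.1 then powSum b.ofLp ρ (gridPoint g) - powSum b.ofLp ρ q.2 else 0
  | .inr (.inr (.inr (.inl j))), q, b => if 0 < q.2 j then 1 - b j else 0
  | .inr (.inr (.inr (.inr (j, k)))), q, b =>
      if ρ = 1 ∧ j ≠ k ∧ 0 < q.2 j ∧ q.2 k < 1 then 1 - (b j * q.1.1 k - b k * q.1.1 j) else 0

theorem ite_nonpos_iff {p : Prop} [Decidable p] {c : ℝ} : (if p then c else 0) ≤ 0 ↔ (p → c ≤ 0) := by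
  split_ifs with h <;> simp [h]

theorem forall_constraint_nonpos_iff {ρ : ℝ} (hρ : 0 < ρ) (q : Market d × Bundle d)
    (b : EuclideanSpace ℝ (Fin d)) :
    (∀ m, constraint ρ m q b ≤ 0) ↔ Explains ρ q.1 q.2 b.ofLp := by
  simp only [Sum.forall, constraint, Prod.forall, ite_nonpos_iff, sub_nonpos, neg_nonpos,
    forall_const]
  constructor
  · rintro ⟨h1, h2, h3, h4, h5⟩
    exact ⟨h1, h2, fun y hy => le_of_forall_gridPoint_le (continuous_powSum _ hρ)
      (fun g => h3 g.1 g.2) hy, h4, fun h j k hjk hj hk => h5 j k ⟨h, hjk, hj, hk⟩⟩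
  · intro h
    exact ⟨h.nonneg, h.one_le_sum, fun n g => h.optimal _, h.one_le,
      fun j k ⟨h1, h2, h3, h4⟩ => h.one_le_swap h1 j k h2 h3 h4⟩

theorem continuous_constraint (ρ : ℝ) (m : ConstraintIndex d) (q : Market d × Bundle d) :
    Continuous (constraint ρ m q) := by
  change Continuous fun b => constraint ρ m q b
  rcases m with j | _ | g | j | ⟨j, k⟩ <;> simp only [constraint]
  · fun_prop
  · fun_prop
  · split_ifs
    · unfold powSum
      fun_prop
    · exact continuous_const
  · split_ifs <;> fun_prop
  · split_ifs <;> fun_prop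

theorem measurable_constraint {ρ : ℝ} (hρ : 0 < ρ) (m : ConstraintIndex d)
    (b : EuclideanSpace ℝ (Fin d)) : Measurable fun q => constraint ρ m q b := by
  rcases m with j | _ | g | j | ⟨j, k⟩ <;> simp only [constraint]
  · exact measurable_const
  · exact measurable_const
  · refine Measurable.ite ?_ ?_ measurable_const
    · simp only [budgetSet, cost, Set.mem_ofPred_eq]
      exact measurableSet_le (by fun_prop) (by fun_prop)
    · exact measurable_const.sub ((continuous_powSum _ hρ).measurable.comp measurable_snd)
  · exact Measurable.ite (measurableSet_lt measurable_const (by fun_prop)) (by fun_prop)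
      measurable_const
  · refine Measurable.ite ?_ (by fun_prop) measurable_const
    have h1 : MeasurableSet {q : Market d × Bundle d | 0 < q.2 j} :=
      measurableSet_lt measurable_const (by fun_prop)
    have h2 : MeasurableSet {q : Market d × Bundle d | q.2 k < 1} :=
      measurableSet_lt (by fun_prop) measurable_const
    exact (MeasurableSet.const _).inter ((MeasurableSet.const _).inter (h1.inter h2))

theorem convex_explains (ρ : ℝ) (z : Market d) (x : Bundle d) :
    Convex ℝ {b : EuclideanSpace ℝ (Fin d) | Explains ρ z x b.ofLp} :=
  fun _ hb _ hc _ _ hs ht hst => hb.convexCombination hc hs ht hst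

theorem isClosed_explains {ρ : ℝ} (hρ : 0 < ρ) (z : Market d) (x : Bundle d) :
    IsClosed {b : EuclideanSpace ℝ (Fin d) | Explains ρ z x b.ofLp} := by
  simp only [← forall_constraint_nonpos_iff hρ (z, x), Set.ofPred_forall]
  exact isClosed_iInter fun m => isClosed_le (continuous_constraint ρ m (z, x)) continuous_const

end Constraints

/-! ### Measurability of demand -/

/-- If there are no ties, then demand is measurable up to a null set. -/
theorem aemeasurable_demand {P : Measure (Market d)} {U : Bundle d → ℝ} (hU : Continuous U)
    (hP : NoTies P U) : AEMeasurable (demand U) P := by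
  have hcost : ∀ x : Bundle d, Measurable fun z : Market d => cost z.1 x := fun x => by
    unfold cost
    fun_prop
  have hbud : Measurable fun z : Market d => (z.2 : ℝ) := by fun_prop
  have hmem := fun z : Market d => demand_mem_cheapestOptimal hU z
  have hv : Measurable fun z => U (demand U z) := by
    refine measurable_of_Ici fun t => ?_
    have : (fun z => U (demand U z)) ⁻¹' Set.Ici t = {z : Market d | ∃ x ∈ Set.univ, ∀ o : Bool,
        cond o (t - U x) (cost z.1 x - z.2) ≤ 0} := by
      ext z
      simp only [Set.mem_preimage, Set.mem_Ici, Set.mem_ofPred_eq, Bool.forall_bool, cond_true, cond_false, sub_nonpos,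
        Set.mem_univ, true_and]
      exact ⟨fun h => ⟨demand U z, (hmem z).1.1, h⟩,
        fun ⟨x, hx, h⟩ => h.trans ((hmem z).1.2 x hx)⟩
    rw [this]
    refine measurableSet_exists_forall_nonpos isClosed_univ ?_ ?_
    · rintro (_ | _) x
      · exact (hcost x).sub hbud
      · exact measurable_const
    · rintro (_ | _) z
      · exact (continuous_cost z.1).sub continuous_const
      · exact continuous_const.sub hU
  have hc : Measurable fun z => cost z.1 (demand U z) := by
    refine measurable_of_Iic fun t => ?_
    have : (fun z => cost z.1 (demand U z)) ⁻¹' Set.Iic t =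
        {z : Market d | ∃ x ∈ Set.univ, ∀ o : Option Bool, o.elim (cost z.1 x - z.2)
          (fun o => cond o (cost z.1 x - t) (U (demand U z) - U x)) ≤ 0} := by
      ext z
      simp only [Set.mem_preimage, Set.mem_Iic, Set.mem_ofPred_eq, Option.forall, Option.elim,
        Bool.forall_bool, cond_true, cond_false, sub_nonpos, Set.mem_univ, true_and]
      exact ⟨fun h => ⟨demand U z, (hmem z).1.1, le_rfl, h⟩, fun ⟨x, hx, h1, h2⟩ =>
        ((hmem z).2 x ⟨hx, fun y hy => ((hmem z).1.2 y hy).trans h1⟩).trans h2⟩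
    rw [this]
    refine measurableSet_exists_forall_nonpos isClosed_univ ?_ ?_
    · rintro (_ | _ | _) x
      · exact (hcost x).sub hbud
      · exact hv.sub measurable_const
      · exact (hcost x).sub measurable_const
    · rintro (_ | _ | _) z
      · exact (continuous_cost z.1).sub continuous_const
      · exact continuous_const.sub hU
      · exact (continuous_cost z.1).sub continuous_const
  obtain ⟨N, hNsub, hNm, hN⟩ := exists_measurable_superset_of_null (ae_iff.1 hP)
  classical
  -- Off `N`, demand is the only affordable bundle attaining both the maximal utility and the
  -- minimal cost, so lexicographic tie-breaking plays no role.
  refine ⟨Set.piecewise N (fun _ _ => 0) (demand U), ?_, ?_⟩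
  · refine measurable_of_isClosed fun A hA => ?_
    have : Set.piecewise N (fun _ _ => 0) (demand U) ⁻¹' A =
        (N ∩ {_z | (fun _ => 0 : Bundle d) ∈ A}) ∪
          (Nᶜ ∩ {z : Market d | ∃ x ∈ A, ∀ o : Option Bool, o.elim (cost z.1 x - z.2)
            (fun o => cond o (cost z.1 x - cost z.1 (demand U z))
              (U (demand U z) - U x)) ≤ 0}) := by
      ext z
      by_cases hz : z ∈ N
      · simp [hz]
      · have huniq : ∃! x, x ∈ cheapestOptimal U z := by
          by_contra h
          exact hz (hNsub h)
        simp only [Set.mem_preimage, Set.piecewise_eq_of_notMem _ _ _ hz, Set.mem_union,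
          Set.mem_inter_iff, hz, false_and, false_or, Set.mem_compl_iff, not_false_eq_true,
          true_and, Set.mem_ofPred_eq, Option.forall, Option.elim, Bool.forall_bool, cond_true, cond_false, sub_nonpos]
        refine ⟨fun h => ⟨_, h, (hmem z).1.1, le_rfl, le_rfl⟩, fun ⟨x, hx, h1, h2, h3⟩ => ?_⟩
        rwa [huniq.unique (hmem z) (mem_cheapestOptimal_of_le (hmem z) h2 h3)]
    rw [this]
    refine (hNm.inter (MeasurableSet.const _)).union (hNm.compl.inter
      (measurableSet_exists_forall_nonpos hA ?_ ?_))
    · rintro (_ | _ | _) x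
      · exact (hcost x).sub hbud
      · exact hv.sub measurable_const
      · exact (hcost x).sub hc
    · rintro (_ | _ | _) z
      · exact (continuous_cost z.1).sub continuous_const
      · exact continuous_const.sub hU
      · exact (continuous_cost z.1).sub continuous_const
  · have : ∀ᵐ z ∂P, z ∉ N := measure_eq_zero_iff_ae_notMem.1 hN
    filter_upwards [this] with z hz
    rw [Set.piecewise_eq_of_notMem _ _ _ hz]

/-! ### The linear class, the learner and its guarantee -/

theorem isLinearClassVia_cesEncoding (d : ℕ) {ρ : ℝ} (hρ : 0 < ρ) :
    IsLinearClassVia (cesEncoding d ρ) (demandClass (cesClass d ρ)) := by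
  rintro _ ⟨_, ⟨a, ha, -, rfl⟩, rfl⟩
  refine ⟨a, fun z y => ?_⟩
  have hx := (demand_mem_cheapestOptimal (continuous_ces a hρ) z).1
  have hR : ∑ j, a j * cesEncoding d ρ z (demand (ces a ρ) z) j =
      powSum a ρ (demand (ces a ρ) z) := by
    unfold cesEncoding
    rw [if_pos hx.1]
    rfl
  rw [hR]
  unfold cesEncoding
  split_ifs with hy
  · exact (ces_le_ces_iff ha hρ _ _).1 (hx.2 y hy)
  · simpa using powSum_nonneg ha ρ _

/-- The weights that explain all observed purchases. -/
def explaining (ρ : ℝ) {n : ℕ} (S : Fin n → Market d × Bundle d) :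
    Set (EuclideanSpace ℝ (Fin d)) :=
  ⋂ i, {b | Explains ρ (S i).1 (S i).2 b.ofLp}

open Classical in
/-- The learner that outputs the weights of minimal norm among those that explain all observed
purchases, scaled to sum one. -/
noncomputable def minNormLearner (d : ℕ) (ρ : ℝ) : Learner d := fun _ S =>
  let w := (minNormPoint (explaining ρ S)).ofLp
  -- The fallback to uniform weights covers the empty sample and samples that no weights explain; in
  -- both cases `w = 0`.
  if (∀ j, 0 ≤ w j) ∧ 0 < ∑ j, w j then ces ((∑ j, w j)⁻¹ • w) ρ else ces (fun _ => (d : ℝ)⁻¹) ρ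

theorem minNormLearner_mem_cesClass (hd : 0 < d) (ρ : ℝ) (n : ℕ)
    (S : Fin n → Market d × Bundle d) : minNormLearner d ρ n S ∈ cesClass d ρ := by
  unfold minNormLearner
  simp only
  split_ifs with h
  · exact ⟨_, fun j => mul_nonneg (inv_nonneg.2 h.2.le) (h.1 j),
      (Finset.mul_sum _ _ _).symm.trans (inv_mul_cancel₀ h.2.ne'), rfl⟩
  · refine ⟨_, fun _ => by positivity, ?_, rfl⟩
    have : (d : ℝ) ≠ 0 := by positivity
    simp [this]

theorem isMinNorm_explaining {ρ : ℝ} (hρ : 0 < ρ) {n : ℕ} {S : Fin n → Market d × Bundle d}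
    (h : (explaining ρ S).Nonempty) :
    IsMinNorm (explaining ρ S) (minNormPoint (explaining ρ S)) :=
  isMinNorm_minNormPoint (isClosed_iInter fun _ => isClosed_explains hρ _ _) h

theorem minNormLearner_eq {ρ : ℝ} (hρ : 0 < ρ) {n : ℕ} (hn : 0 < n)
    {S : Fin n → Market d × Bundle d} (h : (explaining ρ S).Nonempty) :
    minNormLearner d ρ n S = ces ((∑ j, minNormPoint (explaining ρ S) j)⁻¹ •
      (minNormPoint (explaining ρ S)).ofLp) ρ := by
  have hw := Set.mem_iInter.1 (isMinNorm_explaining hρ h).1 ⟨0, hn⟩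
  exact if_pos ⟨hw.nonneg, lt_of_lt_of_le one_pos hw.one_le_sum⟩

open Filter in
/-- If there are no ties, then some weights explain all the purchases. -/
theorem explaining_purchases_nonempty {a : Fin d → ℝ} (ha : ∀ j, 0 ≤ a j) (hsum : ∑ j, a j = 1)
    {ρ : ℝ} (hρ : 0 < ρ) {n : ℕ} {S : Fin n → Market d}
    (hS : ∀ i, ∃! x, x ∈ cheapestOptimal (ces a ρ) (S i)) :
    (explaining ρ (purchases (ces a ρ) S)).Nonempty := by
  have h : ∀ᶠ t : ℝ in atTop, ∀ i, Explains ρ (S i) (demand (ces a ρ) (S i)) (t • a) := by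
    refine eventually_all.2 fun i => ?_
    have hx := demand_mem_cheapestOptimal (continuous_ces a hρ) (S i)
    have hu : ∀ y ∈ cheapestOptimal (ces a ρ) (S i), y = demand (ces a ρ) (S i) :=
      fun y hy => (hS i).unique hy hx
    rw [cheapestOptimal_ces ha hρ] at hx hu
    exact eventually_explains ha hsum hx hu
  obtain ⟨t, ht⟩ := h.exists
  exact ⟨WithLp.toLp 2 (t • a), Set.mem_iInter.2 ht⟩

/-- The failure probability of the learner. -/
theorem pi_minNormLearner_error_le {a : Fin d → ℝ} (ha : ∀ j, 0 ≤ a j) (hsum : ∑ j, a j = 1)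
    {ρ : ℝ} (hρ : 0 < ρ) (hρ1 : ρ ≤ 1) (P : Measure (Market d)) [IsProbabilityMeasure P]
    (hP : NoTies P (ces a ρ)) (ε : ENNReal) {n : ℕ} (hn0 : 0 < n) (hn : d ≤ n) :
    Measure.pi (fun _ : Fin n => P)
        {S | ε < P (errorSet (ces a ρ) (minNormLearner d ρ n (purchases (ces a ρ) S)))}
      ≤ n.choose d * (1 - ε) ^ (n - d) := by
  -- The compression bound is applied to a measurable version `x` of demand and transferred back
  -- almost everywhere.
  obtain ⟨x, hxm, hx⟩ := aemeasurable_demand (continuous_ces a hρ) hP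
  let F : ConstraintIndex d → Market d → EuclideanSpace ℝ (Fin d) → ℝ :=
    fun m z b => constraint ρ m (z, x z) b
  have hF : ∀ z b, (∀ m, F m z b ≤ 0) ↔ Explains ρ z (x z) b.ofLp :=
    fun z b => forall_constraint_nonpos_iff hρ (z, x z) b
  have hbound := pi_minNorm_error_le P (F := F)
    (fun m b => (measurable_constraint hρ m b).comp (measurable_id.prodMk hxm))
    (fun m z => continuous_constraint ρ m (z, x z))
    (fun z => by
      simp only [hF]
      exact convex_explains ρ z (x z)) ε (n := n) (by simpa using hn)
  simp only [hF, finrank_euclideanSpace, Fintype.card_fin] at hbound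
  refine le_trans (measure_mono_ae ?_) hbound
  have hgood : ∀ᵐ z ∂P, (∃! y, y ∈ cheapestOptimal (ces a ρ) z) ∧ demand (ces a ρ) z = x z :=
    hP.and hx
  have hgoodS : ∀ᵐ S ∂Measure.pi (fun _ : Fin n => P), ∀ i,
      (∃! y, y ∈ cheapestOptimal (ces a ρ) (S i)) ∧ demand (ces a ρ) (S i) = x (S i) :=
    Filter.eventually_all.2 fun i =>
      (Measure.tendsto_eval_ae_ae (μ := fun _ : Fin n => P) (i := i)).eventually hgood
  filter_upwards [hgoodS] with S hS hfail
  have hne := explaining_purchases_nonempty ha hsum hρ fun i => (hS i).1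
  set w := minNormPoint (explaining ρ (purchases (ces a ρ) S)) with hw
  have hmin := isMinNorm_explaining hρ hne
  have hset : explaining ρ (purchases (ces a ρ) S) =
      ⋂ i, {b | Explains ρ (S i) (x (S i)) b.ofLp} := by
    simp only [explaining, purchases, fun i => (hS i).2]
  have hfail' : ε < P (errorSet (ces a ρ) (minNormLearner d ρ n (purchases (ces a ρ) S))) := hfail
  rw [minNormLearner_eq hρ hn0 hne] at hfail'
  -- Up to a null set, a market with a prediction error is one whose purchase `w` does not explain.
  refine ⟨w, hset ▸ hmin, hfail'.trans_le (measure_mono_ae ?_)⟩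
  filter_upwards [hgood] with z hz herr hexp
  have hexp' : Explains ρ z (x z) w.ofLp := hexp
  rw [← hz.2] at hexp'
  exact herr (by rw [hexp'.demand_eq ha hρ hρ1 hz.1])

/-- The sample size of the learner. -/
noncomputable def sampleSize (d : ℕ) (ε δ : ℝ) : ℕ :=
  ⌈6 * (((d : ℝ) * Real.log (1 / min ε (1 / 2)) + Real.log (1 / δ)) / min ε (1 / 2))⌉₊

theorem learns_minNormLearner (hd : 0 < d) {ρ : ℝ} (hρ : 0 < ρ) (hρ1 : ρ ≤ 1) :
    Learns (minNormLearner d ρ) (cesClass d ρ) (sampleSize d) := by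
  rintro ε δ hε - hδ hδ1 P hPP _ ⟨a, ha, hsum, rfl⟩ hP n hn
  -- The counting estimate needs `ε ≤ 1 / 2`; larger accuracies are reduced to `1 / 2`.
  set ε' := min ε (1 / 2) with hε'
  have hε'0 : 0 < ε' := lt_min hε (by norm_num)
  have hε'1 : ε' ≤ 1 / 2 := min_le_right _ _
  obtain ⟨hdn, hle⟩ := choose_mul_pow_le hd hε'0 hε'1 hδ hδ1 (Nat.ceil_le.1 hn)
  calc _ ≤ _ := measure_mono fun S hS =>
        lt_of_le_of_lt (ENNReal.ofReal_le_ofReal (min_le_left ε (1 / 2))) hS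
    _ ≤ _ := pi_minNormLearner_error_le ha hsum hρ hρ1 P hP (ENNReal.ofReal ε')
        (hd.trans_le hdn) hdn
    _ = ENNReal.ofReal ((n.choose d : ℝ) * (1 - ε') ^ (n - d)) := by
        rw [ENNReal.ofReal_mul (Nat.cast_nonneg _), ENNReal.ofReal_natCast,
          ENNReal.ofReal_pow (by linarith), ENNReal.ofReal_sub _ hε'0.le, ENNReal.ofReal_one]
    _ ≤ _ := ENNReal.ofReal_le_ofReal hle

/-- Rounding up adds less than 1, and 1 is at most the quotient since `d * log (1 / ε) ≥ log 2 > 1 /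
2 ≥ ε`; hence 7 in place of 6. -/
theorem sampleSize_le (hd : 0 < d) {ε δ : ℝ} (hε : 0 < ε) (hε2 : ε ≤ 1 / 2) (hδ : 0 < δ)
    (hδ1 : δ < 1) :
    (sampleSize d ε δ : ℝ) ≤ 7 * (((d : ℝ) * Real.log (1 / ε) + Real.log (1 / δ)) / ε) := by
  unfold sampleSize
  rw [min_eq_left hε2]
  have hlog2 := Real.log_two_gt_d9
  have hL : Real.log 2 ≤ Real.log (1 / ε) := Real.log_le_log (by norm_num) (by
    rw [le_div_iff₀ hε]
    linarith)
  have hM : 0 ≤ Real.log (1 / δ) := Real.log_nonneg (by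
    rw [le_div_iff₀ hδ]
    linarith)
  have hd1 : (1 : ℝ) ≤ d := by exact_mod_cast hd
  have h1 : 1 ≤ ((d : ℝ) * Real.log (1 / ε) + Real.log (1 / δ)) / ε := by
    rw [le_div_iff₀ hε]
    nlinarith
  have := Nat.ceil_lt_add_one
    (show 0 ≤ 6 * (((d : ℝ) * Real.log (1 / ε) + Real.log (1 / δ)) / ε) by linarith)
  linarith

end RevealedPreference

theorem mainTheorem9 :
    (∀ (d : ℕ) (ρ : ℝ), 0 < ρ → ρ ≤ 1 →
      RevealedPreference.IsLinearClassVia (RevealedPreference.cesEncoding d ρ)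
        (RevealedPreference.demandClass (RevealedPreference.cesClass d ρ))) ∧
    ∃ C : ℝ, 0 < C ∧
      ∀ (d : ℕ), 0 < d → ∀ ρ : ℝ, 0 < ρ → ρ ≤ 1 →
        ∃ (A : RevealedPreference.Learner d) (m : ℝ → ℝ → ℕ),
          (∀ (n : ℕ) (S : Fin n → RevealedPreference.Market d × RevealedPreference.Bundle d),
            A n S ∈ RevealedPreference.cesClass d ρ) ∧
          RevealedPreference.Learns A (RevealedPreference.cesClass d ρ) m ∧
          ∀ ε δ : ℝ, 0 < ε → ε ≤ 1 / 2 → 0 < δ → δ < 1 →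
            (m ε δ : ℝ) ≤ C * (((d : ℝ) * Real.log (1 / ε) + Real.log (1 / δ)) / ε) :=
  ⟨fun d _ hρ _ => RevealedPreference.isLinearClassVia_cesEncoding d hρ, 7, by norm_num,
    fun d hd ρ hρ hρ1 => ⟨RevealedPreference.minNormLearner d ρ, RevealedPreference.sampleSize d,
      RevealedPreference.minNormLearner_mem_cesClass hd ρ,
      RevealedPreference.learns_minNormLearner hd hρ hρ1,
      fun _ _ hε hε2 hδ hδ1 => RevealedPreference.sampleSize_le hd hε hε2 hδ hδ1⟩⟩
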